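/- Let $\mathcal M$ be a finite set of pages, $\pi$ a probability distribution on $\mathcal M$, and $1\le k\le|\mathcal M|$ the cache size. A request can be processed only while the requested page is in the cache, which holds at most $k$ pages; a page that is not in the cache can be loaded at cost $1$, evicting cached pages to make room. For a finite request sequence $\sigma$ let $\mathrm{OPT}(\sigma)$ be the minimum total cost of processing $\sigma$ (with full knowledge of $\sigma$) from a fixed, arbitrary initial cache. Perfect LFU (PLFU) always keeps a set of $k$ most frequent pages under $\pi$ (ties broken arbitrarily) in the cache; when a page $r$ outside the cache is requested, it evicts the $k$-th most frequent page and loads $r$, and right after processing $r$ it evicts $r$ and loads the $k$-th most frequent page back, so that a page fault costs $2$. Let $$\mathrm{RoE}(\mathrm{PLFU})=\limsup_{n\to\infty}\frac{\mathbb E^n_\sigma[\mathrm{PLFU}(\sigma)]}{\mathbb E^n_\sigma[\mathrm{OPT}(\sigma)]},$$ where $\sigma$ consists of $n$ independent requests, each with distribution $\pi$ (and $0/0=0$, which can matter only if at most $k$ pages have positive probability). Then, for every distribution $\pi$, $$\mathrm{RoE}(\mathrm{PLFU})\le 2H_{k+1},\qquad\text{where } H_{k+1}=\sum_{i=1}^{k+1}\frac1i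 ,$$ and $2H_{k+1}=O(\log k)$ as $k\to\infty$. -/

import Mathlib

open scoped ENNReal

namespace Paging

variable {M : Type*} [DecidableEq M]

/-- `Serves k C σ c`: starting with the pages in `C` in the cache, the request sequence `σ` can be
processed with a cache of size `k` by loading pages into the cache exactly `c` times in total.
At any moment a page outside the cache may be loaded, after evicting cached pages to make room for
it (only `S ⊆ C` is kept); each load costs `1`. A request can be processed only while the requested
page is in the cache. -/
inductive Serves (k : ℕ) : Finset M → List M → ℕ → Prop
  | done (C : Finset M) : Serves k C [] 0
  | process (C : Finset M) (r : M) (σ : List M) (c : ℕ) (hr : r ∈ C)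
      (h : Serves k C σ c) : Serves k C (r :: σ) c
  | load (C S : Finset M) (x : M) (σ : List M) (c : ℕ) (hx : x ∉ C) (hS : S ⊆ C)
      (hcard : (insert x S).card ≤ k) (h : Serves k (insert x S) σ c) : Serves k C σ (c + 1)

/-- With a cache of positive size every request sequence can be served, so that the minimum in
`optCost` is over a nonempty set of costs. -/
theorem exists_serves {k : ℕ} (hk : 1 ≤ k) (C : Finset M) (σ : List M) :
    ∃ c, Serves k C σ c := by
  induction σ generalizing C with
  | nil => exact ⟨0, .done C⟩
  | cons r σ ih =>
    by_cases hr : r ∈ C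
    · obtain ⟨c, hc⟩ := ih C
      exact ⟨c, .process C r σ c hr hc⟩
    · obtain ⟨c, hc⟩ := ih (insert r ∅)
      exact ⟨c + 1, .load C ∅ r _ c hr (Finset.empty_subset C) (by simpa using hk)
        (.process _ r σ c (by simp) hc)⟩

/-- The cost of the offline optimal solution for `σ`, with cache size `k` and initial cache
contents `C₀`. -/
noncomputable def optCost (k : ℕ) (C₀ : Finset M) (σ : List M) : ℕ :=
  sInf {c | Serves k C₀ σ c}

/-- `T` consists of the `k` most frequent pages under `π` (ties broken arbitrarily). -/
def IsMostFrequent (π : PMF M) (k : ℕ) (T : Finset M) : Prop :=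
  T.card = k ∧ ∀ x ∈ T, ∀ y ∉ T, π y ≤ π x

/-- `v` is the least frequent page of `T` under `π` (ties broken arbitrarily); if `T` consists of
the `k` most frequent pages, then `v` is the `k`-th most frequent page. -/
def IsLeastFrequentIn (π : PMF M) (T : Finset M) (v : M) : Prop :=
  v ∈ T ∧ ∀ x ∈ T, π v ≤ π x

/-- The cost of Perfect LFU when its current cache is `C` and `v` is the `k`-th most frequent page.
At a page fault on `r`, page `v` is evicted and `r` is loaded; right after processing `r`, page `r`
is evicted and `v` is loaded back. These are two loads. -/
def plfuCost (v : M) : Finset M → List M → ℕ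
  | _, [] => 0
  | C, r :: σ =>
    if r ∈ C then plfuCost v C σ
    else 1 + 1 + plfuCost v (insert v ((insert r (C.erase v)).erase r)) σ

/-- The expectation of `cost σ` for a random sequence `σ` of `n` independent requests, each drawn
from the distribution `π`. -/
noncomputable def expectedCost [Fintype M] (π : PMF M) (n : ℕ) (cost : List M → ℕ) : ℝ≥0∞ :=
  ∑ σ : Fin n → M, (∏ i, π (σ i)) * (cost (List.ofFn σ) : ℝ≥0∞)

/-- The ratio-of-expectations of an algorithm with cost function `alg`, relative to the optimal
cost function `opt`, as an extended nonnegative real number. -/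
noncomputable def ratioOfExpectations [Fintype M] (π : PMF M) (alg opt : List M → ℕ) : ℝ≥0∞ :=
  Filter.limsup (fun n : ℕ => expectedCost π n alg / expectedCost π n opt) Filter.atTop

end Paging

/-! PLFU returns to its set `T` after every fault, so its mean cost is exactly `2nμ`, where `μ` is
the probability that a request misses `T`. It remains to bound the mean of OPT below by `nμ /
H_{k+1} - k`.

A chain `P 0 ⊂ ... ⊂ P k` tracks the optimal offline caches, and up to an additive `k` OPT pays for
each request outside `P k` (`chainCount_le_optCost`). A potential of the layer sizes rises by
`H_{k+1} - 1` on such a request and falls by some `d x ≥ 0` on a request to `x ∈ P k`. Thus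
`H_{k+1}` per counted request, plus the fall of the potential, leaves 1 outside `P k` and `d x`
inside. Holding the fraction `1 - min 1 (d x)` of each `x ∈ P k` is a fractional cache of size at
most `k` (`IsChain.card_sub_le_sum_min`), so it misses with probability at least `μ`. This is the
drift inequality `IsChain.one_sub_le_drift`; summing it over `n` requests gives the bound. -/

namespace Paging

variable {M : Type*} [DecidableEq M]

/-! ### Chains and the lower bound on OPT -/

/-- A work function of the paging problem, given by an increasing chain: a cache `C` of at most `k`
pages is optimal for it if it has at most `k - j` pages outside `P j`, for every `j ≤ k`. -/
structure IsChain (k : ℕ) (P : ℕ → Finset M) : Prop where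
  zero : P 0 = ∅
  ssubset : ∀ j < k, P j ⊂ P (j + 1)

/-- The chain after a request to `r`. -/
def chainStep (k : ℕ) (P : ℕ → Finset M) (r : M) : ℕ → Finset M
  | 0 => ∅
  | j + 1 =>
    if r ∈ P k then (if r ∈ P j then P (j + 1) else insert r (P j)) else insert r (P (j + 1))

/-- The number of requests to pages that lie outside the chain. -/
def chainCount (k : ℕ) : (ℕ → Finset M) → List M → ℕ
  | _, [] => 0
  | P, r :: σ => (if r ∈ P k then 0 else 1) + chainCount k (chainStep k P r) σ

/-- The number of loads by which the cache `C` is off the optimal ones for the chain `P`. -/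
def chainDist (k : ℕ) (P : ℕ → Finset M) (C : Finset M) : ℕ :=
  (Finset.range (k + 1)).sup fun j => (C \ P j).card - (k - j)

omit [DecidableEq M] in
theorem IsChain.subset {k : ℕ} {P : ℕ → Finset M} (hP : IsChain k P) {i j : ℕ} (hij : i ≤ j)
    (hj : j ≤ k) : P i ⊆ P j := by
  induction j, hij using Nat.le_induction with
  | base => exact Finset.Subset.refl _
  | succ j _ ih => exact (ih (by omega)).trans (hP.ssubset j (by omega)).subset

omit [DecidableEq M] in
theorem IsChain.card_lt {k : ℕ} {P : ℕ → Finset M} (hP : IsChain k P) {j : ℕ} (hj : j < k) :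
    (P j).card + 1 ≤ (P (j + 1)).card :=
  Finset.card_lt_card (hP.ssubset j hj)

theorem IsChain.step {k : ℕ} {P : ℕ → Finset M} (hP : IsChain k P) (r : M) :
    IsChain k (chainStep k P r) := by
  refine ⟨rfl, fun j hj => ?_⟩
  by_cases hr : r ∈ P k
  · have h1 := hP.ssubset j hj
    cases j with
    | zero =>
      simp only [chainStep, hr, hP.zero, if_true, Finset.notMem_empty, if_false]
      exact Finset.empty_ssubset.2 (Finset.insert_nonempty _ _)
    | succ j =>
      have h0 := hP.ssubset j (by omega)
      simp only [chainStep, hr, if_true]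
      by_cases ha : r ∈ P j
      · rw [if_pos ha, if_pos (h0.subset ha)]
        exact h1
      · rw [if_neg ha]
        by_cases hb : r ∈ P (j + 1)
        · rw [if_pos hb]
          exact (Finset.insert_subset hb h0.subset).trans_ssubset h1
        · rw [if_neg hb]
          refine Finset.ssubset_iff_subset_ne.2 ⟨Finset.insert_subset_insert _ h0.subset, ?_⟩
          intro he
          have := congrArg Finset.card he
          rw [Finset.card_insert_of_notMem ha, Finset.card_insert_of_notMem hb] at this
          have := Finset.card_lt_card h0
          omega
  · cases j with
    | zero =>
      simp only [chainStep, hr, if_false]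
      exact Finset.empty_ssubset.2 (Finset.insert_nonempty _ _)
    | succ j =>
      have h1 := hP.ssubset (j + 1) hj
      simp only [chainStep, hr, if_false]
      refine Finset.ssubset_iff_subset_ne.2 ⟨Finset.insert_subset_insert _ h1.subset, ?_⟩
      intro he
      have := congrArg Finset.card he
      rw [Finset.card_insert_of_notMem fun h => hr (hP.subset (by omega) (by omega) h),
        Finset.card_insert_of_notMem fun h => hr (hP.subset (by omega) (by omega) h)] at this
      have := Finset.card_lt_card h1
      omega

theorem card_sdiff_insert_add_one {C A : Finset M} {r : M} (hr : r ∈ C) (hA : r ∉ A) :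
    (C \ insert r A).card + 1 = (C \ A).card := by
  rw [Finset.sdiff_insert, Finset.card_erase_add_one (Finset.mem_sdiff.2 ⟨hr, hA⟩)]

/-- If `r ∈ P k`, a layer built from `P j` by adding `r` loses one page of `C`, just as its
allowance drops from `k - j` to `k - (j + 1)`. If `r ∉ P k`, every layer of positive index gains `r
∈ C` at unchanged allowance, and `r` itself shows that the distance was positive. -/
theorem chainDist_step {k : ℕ} {P : ℕ → Finset M} (hP : IsChain k P) {C : Finset M}
    (hC : C.card ≤ k) {r : M} (hr : r ∈ C) :
    (if r ∈ P k then 0 else 1) + chainDist k (chainStep k P r) C ≤ chainDist k P C := by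
  have hle : ∀ j ≤ k, (C \ P j).card - (k - j) ≤ chainDist k P C := fun j hj =>
    Finset.le_sup (f := fun j => (C \ P j).card - (k - j)) (Finset.mem_range.2 (by omega))
  by_cases hk : r ∈ P k
  · rw [if_pos hk, zero_add]
    refine Finset.sup_le fun j hj => ?_
    have hj' := Finset.mem_range.1 hj
    cases j with
    | zero => simp only [chainStep, Finset.sdiff_empty]; omega
    | succ j =>
      simp only [chainStep, hk, if_true]
      by_cases hb : r ∈ P j
      · rw [if_pos hb]
        exact hle _ (by omega)
      · rw [if_neg hb]
        have := card_sdiff_insert_add_one hr hb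
        have := hle j (by omega)
        omega
  · rw [if_neg hk]
    have h1 : 1 ≤ chainDist k P C := by
      have := hle k le_rfl
      have : 0 < (C \ P k).card := Finset.card_pos.2 ⟨r, Finset.mem_sdiff.2 ⟨hr, hk⟩⟩
      omega
    have : chainDist k (chainStep k P r) C ≤ chainDist k P C - 1 := by
      refine Finset.sup_le fun j hj => ?_
      have hj' := Finset.mem_range.1 hj
      cases j with
      | zero => simp only [chainStep, Finset.sdiff_empty]; omega
      | succ j =>
        simp only [chainStep, hk, if_false]
        have := card_sdiff_insert_add_one hr
          fun h => hk (hP.subset (show j + 1 ≤ k by omega) le_rfl h)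
        have := hle (j + 1) (by omega)
        omega
    omega

theorem chainDist_load {k : ℕ} (P : ℕ → Finset M) {C S : Finset M} (hS : S ⊆ C) (x : M) :
    chainDist k P (insert x S) ≤ chainDist k P C + 1 := by
  refine Finset.sup_le fun j hj => ?_
  have h1 : (C \ P j).card - (k - j) ≤ chainDist k P C :=
    Finset.le_sup (f := fun j => (C \ P j).card - (k - j)) hj
  have h2 : (insert x S \ P j).card ≤ (C \ P j).card + 1 := by
    refine (Finset.card_le_card (t := insert x (C \ P j)) ?_).trans (Finset.card_insert_le _ _)
    intro y
    simp only [Finset.mem_sdiff, Finset.mem_insert]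
    rintro ⟨rfl | hy, h⟩
    · exact Or.inl rfl
    · exact Or.inr ⟨hS hy, h⟩
  omega

theorem chainCount_le_of_serves {k : ℕ} {C : Finset M} {σ : List M} {c : ℕ}
    (h : Serves k C σ c) (hC : C.card ≤ k) {P : ℕ → Finset M} (hP : IsChain k P) :
    chainCount k P σ ≤ c + chainDist k P C := by
  induction h generalizing P with
  | done C => simp [chainCount]
  | process C r σ c hr _ ih =>
    have h1 := ih hC (hP.step r)
    have h2 := chainDist_step hP hC hr
    simp only [chainCount]
    omega
  | load C S x σ c hx hS hcard _ ih =>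
    have h1 := ih hcard hP
    have h2 := chainDist_load (k := k) P hS x
    omega

/-- The work functions bound the optimal cost from below. -/
theorem chainCount_le_optCost {k : ℕ} (hk : 1 ≤ k) {C : Finset M} (hC : C.card ≤ k)
    {P : ℕ → Finset M} (hP : IsChain k P) (σ : List M) :
    chainCount k P σ ≤ optCost k C σ + k := by
  have h := Nat.sInf_mem (s := {c | Serves k C σ c}) (exists_serves hk C σ)
  refine (chainCount_le_of_serves h hC hP).trans (Nat.add_le_add_left ?_ _)
  refine Finset.sup_le fun j _ => ?_
  have := Finset.card_le_card (Finset.sdiff_subset (s := C) (t := P j))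
  omega

/-! ### The potential and its changes -/

/-- The potential of a chain. -/
noncomputable def chainPotential (k : ℕ) (P : ℕ → Finset M) : ℝ :=
  ∑ j ∈ Finset.range k, (((P (j + 1)).card : ℝ) - (j + 1 : ℕ)) / (k + 1 - j)

omit [DecidableEq M] in
theorem IsChain.le_card {k : ℕ} {P : ℕ → Finset M} (hP : IsChain k P) {j : ℕ} (hj : j ≤ k) :
    j ≤ (P j).card := by
  induction j with
  | zero => exact Nat.zero_le _
  | succ j ih =>
    have := ih (by omega)
    have := hP.card_lt (show j < k by omega)
    omega

omit [DecidableEq M] in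
theorem IsChain.potential_nonneg {k : ℕ} {P : ℕ → Finset M} (hP : IsChain k P) :
    0 ≤ chainPotential k P := by
  refine Finset.sum_nonneg fun j hj => div_nonneg ?_ ?_
  · exact sub_nonneg.2 (Nat.cast_le.2 (hP.le_card (Finset.mem_range.1 hj)))
  · have : (j : ℝ) < k := Nat.cast_lt.2 (Finset.mem_range.1 hj)
    linarith

theorem sum_range_inv_eq_harmonic (k : ℕ) :
    ∑ j ∈ Finset.range k, 1 / ((k : ℝ) + 1 - j) = (harmonic (k + 1) : ℝ) - 1 := by
  rw [harmonic, Finset.sum_range_succ', ← Finset.sum_range_reflect]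
  push_cast
  simp only [inv_one, add_sub_cancel_right]
  refine Finset.sum_congr rfl fun j hj => ?_
  have hj := Finset.mem_range.1 hj
  rw [Nat.sub_sub, Nat.cast_sub (by omega), one_div]
  push_cast
  congr 1
  ring

theorem IsChain.potential_step_of_notMem {k : ℕ} {P : ℕ → Finset M} (hP : IsChain k P) {r : M}
    (hr : r ∉ P k) :
    chainPotential k (chainStep k P r) = chainPotential k P + ((harmonic (k + 1) : ℝ) - 1) := by
  rw [← sum_range_inv_eq_harmonic, chainPotential, chainPotential, ← Finset.sum_add_distrib]
  refine Finset.sum_congr rfl fun j hj => ?_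
  have hj := Finset.mem_range.1 hj
  have h : r ∉ P (j + 1) := fun h => hr (hP.subset hj le_rfl h)
  simp only [chainStep, hr, if_false, Finset.card_insert_of_notMem h]
  rw [← add_div]
  push_cast
  congr 1
  ring

/-- The decrease of the potential that the `j`-th layer accounts for. -/
noncomputable def chainGap (k : ℕ) (P : ℕ → Finset M) (j : ℕ) : ℝ :=
  (((P (j + 1)).card : ℝ) - (P j).card - 1) / (k + 1 - j)

omit [DecidableEq M] in
theorem IsChain.gap_nonneg {k : ℕ} {P : ℕ → Finset M} (hP : IsChain k P) {j : ℕ} (hj : j < k) :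
    0 ≤ chainGap k P j := by
  have h1 : ((P j).card : ℝ) + 1 ≤ (P (j + 1)).card := by exact_mod_cast hP.card_lt hj
  have h2 : (j : ℝ) < k := Nat.cast_lt.2 hj
  exact div_nonneg (by linarith) (by linarith)

theorem potential_sub_step_of_mem {k : ℕ} {P : ℕ → Finset M} {r : M} (hr : r ∈ P k) :
    chainPotential k P - chainPotential k (chainStep k P r) =
      ∑ j ∈ Finset.range k, if r ∈ P j then 0 else chainGap k P j := by
  rw [chainPotential, chainPotential, ← Finset.sum_sub_distrib]
  refine Finset.sum_congr rfl fun j _ => ?_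
  simp only [chainStep, hr, if_true]
  by_cases h : r ∈ P j
  · simp [h]
  · simp only [h, if_false, chainGap, Finset.card_insert_of_notMem h]
    rw [← sub_div]
    push_cast
    congr 1
    ring

omit [DecidableEq M] in
/-- The layers up to `I` yield enough potential if they do not yield more than `1` per page. -/
theorem IsChain.le_sum_gap {k : ℕ} {P : ℕ → Finset M} (hP : IsChain k P) {I : ℕ} (hI : I ≤ k)
    (h1 : ∑ j ∈ Finset.range I, chainGap k P j ≤ 1) :
    ((P I).card : ℝ) - k ≤
      ∑ j ∈ Finset.range I, chainGap k P j * ((P I).card - (P j).card) := by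
  have hterm : ∀ j ∈ Finset.range I,
      (((P (j + 1)).card : ℝ) - (j + 1 : ℕ)) - ((P j).card - (j : ℕ))
        - (k - I) * chainGap k P j ≤ chainGap k P j * ((P I).card - (P j).card) := by
    intro j hj
    have hj := Finset.mem_range.1 hj
    have hjk : (j : ℝ) + 1 ≤ k := by exact_mod_cast (by omega : j + 1 ≤ k)
    have hg := hP.gap_nonneg (show j < k by omega)
    have hmul : chainGap k P j * (k + 1 - j) = ((P (j + 1)).card : ℝ) - (P j).card - 1 :=
      div_mul_cancel₀ _ (by linarith)
    -- A nonzero gap means that layer `j + 1` adds at least two pages; each later layer adds at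
    -- least one.
    have hlow : chainGap k P j * (I - j + 1) ≤ chainGap k P j * ((P I).card - (P j).card) := by
      rcases hg.eq_or_lt with h0 | h0
      · rw [← h0, zero_mul, zero_mul]
      · refine mul_le_mul_of_nonneg_left ?_ hg
        have hpos : 0 < ((P (j + 1)).card : ℝ) - (P j).card - 1 := by
          rw [← hmul]; exact mul_pos h0 (by linarith)
        have hpos' : (P j).card + 1 < (P (j + 1)).card := by
          have : ((P j).card : ℝ) + 1 < (P (j + 1)).card := by linarith
          exact_mod_cast this
        have : ∀ i, j + 1 ≤ i → i ≤ k → (P j).card + i + 1 ≤ (P i).card + j := by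
          intro i hi
          induction i, hi using Nat.le_induction with
          | base => intro _; omega
          | succ i _ ih =>
            intro hik
            have := ih (by omega)
            have := hP.card_lt (show i < k by omega)
            omega
        have : ((P j).card : ℝ) + I + 1 ≤ (P I).card + j := by exact_mod_cast this I hj hI
        linarith
    push_cast
    nlinarith
  have hsum := Finset.sum_le_sum hterm
  -- The left side telescopes to `|P I| - I - (k - I) * ∑ gap`, and `∑ gap ≤ 1`.
  rw [Finset.sum_sub_distrib, ← Finset.mul_sum,
    Finset.sum_range_sub (fun j => ((P j).card : ℝ) - (j : ℕ))] at hsum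
  have hkI : (0 : ℝ) ≤ k - I := sub_nonneg.2 (Nat.cast_le.2 hI)
  have := mul_le_mul_of_nonneg_left h1 hkI
  simp only [hP.zero, Finset.card_empty, Nat.cast_zero, sub_zero] at hsum
  linarith

/-- The pages of the chain, with truncated potential decreases as their miss probabilities, fit into
a cache of size `k`. -/
theorem IsChain.card_sub_le_sum_min {k : ℕ} {P : ℕ → Finset M} (hP : IsChain k P) :
    ((P k).card : ℝ) - k ≤
      ∑ x ∈ P k, min 1 (chainPotential k P - chainPotential k (chainStep k P x)) := by
  -- `I` is the truncation level: pages outside `P I` reach the cap 1, while inside `P I` the gaps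
  -- below `I` stay within it.
  obtain ⟨I, hI, h1, hmax⟩ : ∃ I ≤ k, ∑ j ∈ Finset.range I, chainGap k P j ≤ 1 ∧
      (I < k → 1 < ∑ j ∈ Finset.range (I + 1), chainGap k P j) := by
    let p : ℕ → Prop := fun i => ∑ j ∈ Finset.range i, chainGap k P j ≤ 1
    classical
    have h0 : p 0 := by simp [p]
    refine ⟨Nat.findGreatest p k, Nat.findGreatest_le k,
      Nat.findGreatest_spec (P := p) (Nat.zero_le k) h0, fun h => ?_⟩
    exact not_le.1 (Nat.findGreatest_is_greatest (P := p) (Nat.lt_succ_self _) h)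
  have hsub := hP.subset hI le_rfl
  rw [← Finset.sum_sdiff hsub]
  have hhigh : ((P k \ P I).card : ℝ) ≤ ∑ x ∈ P k \ P I,
      min 1 (chainPotential k P - chainPotential k (chainStep k P x)) := by
    rw [Finset.card_eq_sum_ones, Nat.cast_sum, Nat.cast_one]
    refine Finset.sum_le_sum fun x hx => le_min le_rfl ?_
    obtain ⟨hxk, hxI⟩ := Finset.mem_sdiff.1 hx
    have hIk : I < k := lt_of_le_of_ne hI fun h => hxI (h ▸ hxk)
    rw [potential_sub_step_of_mem hxk]
    refine (hmax hIk).le.trans ?_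
    calc ∑ j ∈ Finset.range (I + 1), chainGap k P j
        = ∑ j ∈ Finset.range (I + 1), (if x ∈ P j then 0 else chainGap k P j) := by
          refine Finset.sum_congr rfl fun j hj => (if_neg fun h => hxI ?_).symm
          exact hP.subset (Nat.lt_succ_iff.1 (Finset.mem_range.1 hj)) hI h
      _ ≤ _ := by
          refine Finset.sum_le_sum_of_subset_of_nonneg (Finset.range_mono hIk) fun j hj _ => ?_
          split_ifs
          · exact le_rfl
          · exact hP.gap_nonneg (Finset.mem_range.1 hj)
  have hlow : ((P I).card : ℝ) - k ≤ ∑ x ∈ P I,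
      min 1 (chainPotential k P - chainPotential k (chainStep k P x)) := by
    calc ((P I).card : ℝ) - k
        ≤ ∑ j ∈ Finset.range I, chainGap k P j * ((P I).card - (P j).card) := hP.le_sum_gap hI h1
      _ = ∑ j ∈ Finset.range I, ∑ x ∈ P I, if x ∈ P j then 0 else chainGap k P j := by
          refine Finset.sum_congr rfl fun j hj => ?_
          have hj := Finset.mem_range.1 hj
          have hs := hP.subset hj.le hI
          rw [← Finset.sum_sdiff hs, Finset.sum_congr rfl fun x hx => if_neg
            (Finset.mem_sdiff.1 hx).2, Finset.sum_congr (s₁ := P j) rfl fun x hx => if_pos hx,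
            Finset.sum_const_zero, add_zero, Finset.sum_const, Finset.card_sdiff_of_subset hs,
            nsmul_eq_mul, Nat.cast_sub (Finset.card_le_card hs), mul_comm]
      _ = ∑ x ∈ P I, ∑ j ∈ Finset.range I, if x ∈ P j then 0 else chainGap k P j :=
          Finset.sum_comm
      _ ≤ _ := by
          refine Finset.sum_le_sum fun x hx => ?_
          have hnn : ∀ j < k, 0 ≤ if x ∈ P j then 0 else chainGap k P j := fun j hj => by
            split_ifs
            · exact le_rfl
            · exact hP.gap_nonneg hj
          refine le_min (le_trans (Finset.sum_le_sum fun j hj => ?_) h1) ?_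
          · split_ifs
            · exact hP.gap_nonneg ((Finset.mem_range.1 hj).trans_le hI)
            · exact le_rfl
          · rw [potential_sub_step_of_mem (hsub hx)]
            exact Finset.sum_le_sum_of_subset_of_nonneg (Finset.range_mono hI)
              fun j hj _ => hnn j (Finset.mem_range.1 hj)
  rw [Finset.card_sdiff_of_subset hsub, Nat.cast_sub (Finset.card_le_card hsub)] at hhigh
  linarith

/-- Layers with `|P j| = j` have zero potential. The chain need not match the initial cache, since
the additive `k` absorbs the mismatch. -/
theorem exists_isChain {k : ℕ} {T : Finset M} (hT : T.card = k) :
    ∃ P : ℕ → Finset M, IsChain k P ∧ chainPotential k P = 0 := by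
  have hcard : ∀ j ≤ k, (T.toList.take j).toFinset.card = j := fun j hj => by
    rw [List.toFinset_card_of_nodup (T.nodup_toList.sublist (List.take_sublist _ _)),
      List.length_take, Finset.length_toList]
    omega
  refine ⟨fun j => (T.toList.take j).toFinset, ⟨rfl, fun j hj => ?_⟩, ?_⟩
  · refine Finset.ssubset_iff_subset_ne.2 ⟨fun x hx => ?_, fun h => ?_⟩
    · rw [List.mem_toFinset] at hx ⊢
      exact (List.take_subset_take_left _ (Nat.le_succ j)) hx
    · have h1 := hcard j hj.le
      rw [h, hcard (j + 1) hj] at h1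
      omega
  · refine Finset.sum_eq_zero fun j hj => ?_
    rw [hcard _ (Finset.mem_range.1 hj), sub_self, zero_div]

/-! ### Fractional caches and mean costs -/

omit [DecidableEq M] in
/-- No fractional cache of size `k` is hit more often than the `k` most frequent pages. -/
theorem sum_mul_le_sum_of_mostFrequent [Fintype M] {p q : M → ℝ} {k : ℕ} {T : Finset M}
    (hT : T.card = k) {v : M} (hv : 0 ≤ p v) (hTv : ∀ x ∈ T, p v ≤ p x) (hvT : ∀ x ∉ T, p x ≤ p v)
    (hq0 : ∀ x, 0 ≤ q x) (hq1 : ∀ x, q x ≤ 1) (hq : ∑ x, q x ≤ k) :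
    ∑ x, p x * q x ≤ ∑ x ∈ T, p x := by
  classical
  -- Linear programming duality, with `p v` as the price of a unit of cache space.
  have h : ∀ x, p x * q x ≤ (if x ∈ T then p x else 0) + p v * (q x - if x ∈ T then 1 else 0) := by
    intro x
    split_ifs with hx
    · nlinarith [hTv x hx, hq1 x]
    · nlinarith [hvT x hx, hq0 x]
  refine (Finset.sum_le_sum fun x _ => h x).trans ?_
  rw [Finset.sum_add_distrib, ← Finset.mul_sum, Finset.sum_sub_distrib]
  simp only [Finset.sum_ite_mem, Finset.univ_inter, Finset.sum_const, hT, nsmul_eq_mul, mul_one]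
  nlinarith

/-- The mean of `cost σ` for a random sequence `σ` of `n` independent requests. -/
def meanCost [Fintype M] (p : M → ℝ) : ℕ → (List M → ℝ) → ℝ
  | 0, f => f []
  | n + 1, f => ∑ x, p x * meanCost p n fun σ => f (x :: σ)

section meanCost

variable [Fintype M] {p : M → ℝ}

omit [DecidableEq M] in
theorem meanCost_mono (hp : ∀ x, 0 ≤ p x) (n : ℕ) {f g : List M → ℝ} (h : ∀ σ, f σ ≤ g σ) :
    meanCost p n f ≤ meanCost p n g := by
  induction n generalizing f g with
  | zero => exact h _
  | succ n ih =>
    exact Finset.sum_le_sum fun x _ => mul_le_mul_of_nonneg_left (ih fun σ => h _) (hp x)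

omit [DecidableEq M] in
theorem meanCost_add_const (h1 : ∑ x, p x = 1) (n : ℕ) (f : List M → ℝ) (c : ℝ) :
    meanCost p n (fun σ => f σ + c) = meanCost p n f + c := by
  induction n generalizing f with
  | zero => rfl
  | succ n ih =>
    simp only [meanCost, ih, mul_add, Finset.sum_add_distrib, ← Finset.sum_mul, h1, one_mul]

omit [DecidableEq M] in
theorem meanCost_nonneg (hp : ∀ x, 0 ≤ p x) (n : ℕ) {f : List M → ℝ} (h : ∀ σ, 0 ≤ f σ) :
    0 ≤ meanCost p n f := by
  induction n generalizing f with
  | zero => exact h _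
  | succ n ih => exact Finset.sum_nonneg fun x _ => mul_nonneg (hp x) (ih fun σ => h _)

omit [DecidableEq M] in
theorem expectedCost_eq_ofReal (π : PMF M) (n : ℕ) (cost : List M → ℕ) :
    expectedCost π n cost =
      ENNReal.ofReal (meanCost (fun x => (π x).toReal) n fun σ => (cost σ : ℝ)) := by
  induction n generalizing cost with
  | zero => simp [expectedCost, meanCost]
  | succ n ih =>
    rw [meanCost, ENNReal.ofReal_sum_of_nonneg fun x _ => mul_nonneg ENNReal.toReal_nonneg
      (meanCost_nonneg (fun x => ENNReal.toReal_nonneg) n fun σ => Nat.cast_nonneg _)]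
    rw [expectedCost, ← (Fin.consEquiv fun _ => M).sum_comp, Fintype.sum_prod_type]
    refine Finset.sum_congr rfl fun x _ => ?_
    rw [ENNReal.ofReal_mul ENNReal.toReal_nonneg, ENNReal.ofReal_toReal (π.apply_ne_top x),
      ← ih fun σ => cost (x :: σ), expectedCost, Finset.mul_sum]
    refine Finset.sum_congr rfl fun σ _ => ?_
    simp [Fin.consEquiv, Fin.prod_univ_succ, List.ofFn_succ, mul_assoc]

theorem meanCost_plfu (h1 : ∑ x, p x = 1) {T : Finset M} {v : M} (hv : v ∈ T) (n : ℕ) :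
    meanCost p n (fun σ => (plfuCost v T σ : ℝ)) = 2 * (n * (1 - ∑ x ∈ T, p x)) := by
  induction n with
  | zero => simp [meanCost, plfuCost]
  | succ n ih =>
    have hx : ∀ x, (meanCost p n fun σ => (plfuCost v T (x :: σ) : ℝ)) =
        2 * (n * (1 - ∑ x ∈ T, p x)) + (2 - if x ∈ T then 2 else 0) := by
      intro x
      by_cases hxT : x ∈ T
      · simp [plfuCost, hxT, ih]
      · have : insert v ((insert x (T.erase v)).erase x) = T := by
          rw [Finset.erase_insert fun h => hxT (Finset.mem_of_mem_erase h), Finset.insert_erase hv]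
        simp only [plfuCost, hxT, if_false, this, sub_zero]
        rw [← ih, ← meanCost_add_const h1]
        congr 1
        funext σ
        push_cast
        ring
    simp only [meanCost, hx, mul_add, mul_sub, Finset.sum_add_distrib, Finset.sum_sub_distrib,
      ← Finset.sum_mul, h1, mul_ite, mul_zero, Finset.sum_ite_mem, Finset.univ_inter]
    push_cast
    ring

/-! ### Drift and its summation over the requests -/

/-- The drift inequality for one random request. -/
theorem IsChain.one_sub_le_drift {k : ℕ} {P : ℕ → Finset M} (hP : IsChain k P)
    (hp : ∀ x, 0 ≤ p x) (h1 : ∑ x, p x = 1) {T : Finset M} (hT : T.card = k) {v : M}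
    (hTv : ∀ x ∈ T, p v ≤ p x) (hvT : ∀ x ∉ T, p x ≤ p v) :
    1 - ∑ x ∈ T, p x ≤ ∑ x, p x * ((harmonic (k + 1) : ℝ) * (if x ∈ P k then 0 else 1) +
      (chainPotential k P - chainPotential k (chainStep k P x))) := by
  set d : M → ℝ := fun x => chainPotential k P - chainPotential k (chainStep k P x) with hd
  -- Miss fractions; the fractional cache is `1 - c`.
  set c : M → ℝ := fun x => if x ∈ P k then min 1 (d x) else 1 with hc
  have hd0 : ∀ x ∈ P k, 0 ≤ d x := fun x hx => by
    rw [hd]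
    simp only [potential_sub_step_of_mem hx]
    refine Finset.sum_nonneg fun j hj => ?_
    split_ifs
    · exact le_rfl
    · exact hP.gap_nonneg (Finset.mem_range.1 hj)
  have hc0 : ∀ x, 0 ≤ c x := fun x => by
    simp only [hc]
    split_ifs with hx
    · exact le_min zero_le_one (hd0 x hx)
    · exact zero_le_one
  have hc1 : ∀ x, c x ≤ 1 := fun x => by
    simp only [hc]
    split_ifs
    · exact min_le_left _ _
    · exact le_rfl
  have hsum : ∑ x, (1 - c x) ≤ k := by
    have : ∀ x, 1 - c x = if x ∈ P k then 1 - min 1 (d x) else 0 := fun x => by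
      simp only [hc]
      split_ifs <;> ring
    simp only [this, Finset.sum_ite_mem, Finset.univ_inter, Finset.sum_sub_distrib,
      Finset.sum_const, nsmul_eq_mul, mul_one]
    have := hP.card_sub_le_sum_min
    linarith
  have hpv : 0 ≤ p v := hp v
  have hhit := sum_mul_le_sum_of_mostFrequent hT hpv hTv hvT (q := fun x => 1 - c x)
    (fun x => sub_nonneg.2 (hc1 x)) (fun x => sub_le_self _ (hc0 x)) hsum
  simp only [mul_sub, mul_one, Finset.sum_sub_distrib, h1] at hhit
  calc 1 - ∑ x ∈ T, p x ≤ ∑ x, p x * c x := by linarith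
    _ ≤ _ := by
      refine Finset.sum_le_sum fun x _ => mul_le_mul_of_nonneg_left ?_ (hp x)
      simp only [hc]
      split_ifs with hx
      · rw [mul_zero, zero_add]
        exact min_le_right _ _
      · rw [hP.potential_step_of_notMem hx]
        linarith

theorem IsChain.mul_le_meanCost_count {k : ℕ} {P : ℕ → Finset M} (hP : IsChain k P)
    (hp : ∀ x, 0 ≤ p x) (h1 : ∑ x, p x = 1) {T : Finset M} (hT : T.card = k) {v : M}
    (hTv : ∀ x ∈ T, p v ≤ p x) (hvT : ∀ x ∉ T, p x ≤ p v) (n : ℕ) :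
    n * (1 - ∑ x ∈ T, p x) ≤ (harmonic (k + 1) : ℝ) *
      meanCost p n (fun σ => (chainCount k P σ : ℝ)) + chainPotential k P := by
  induction n generalizing P with
  | zero => simpa [meanCost, chainCount] using hP.potential_nonneg
  | succ n ih =>
    have hdrift := hP.one_sub_le_drift hp h1 hT hTv hvT
    have hih := Finset.sum_le_sum fun x (_ : x ∈ Finset.univ) =>
      mul_le_mul_of_nonneg_left (ih (hP.step x)) (hp x)
    rw [← Finset.sum_mul, h1, one_mul] at hih
    have hadd := add_le_add hih hdrift
    rw [← Finset.sum_add_distrib] at hadd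
    push_cast
    rw [add_mul, one_mul]
    refine hadd.trans (le_of_eq ?_)
    have hx : ∀ x, (meanCost p n fun σ => (chainCount k P (x :: σ) : ℝ)) =
        meanCost p n (fun σ => (chainCount k (chainStep k P x) σ : ℝ)) +
          if x ∈ P k then 0 else 1 := by
      intro x
      rw [← meanCost_add_const h1]
      congr 1
      funext σ
      simp only [chainCount]
      push_cast
      ring
    have hΦ : chainPotential k P = ∑ x, p x * chainPotential k P := by
      rw [← Finset.sum_mul, h1, one_mul]
    simp only [meanCost, hx]
    conv_rhs => rw [hΦ]
    rw [Finset.mul_sum, ← Finset.sum_add_distrib]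
    exact Finset.sum_congr rfl fun x _ => by ring

end meanCost

/-! ### The limit and the logarithmic bound -/

theorem one_le_harmonic_succ (k : ℕ) : (1 : ℝ) ≤ (harmonic (k + 1) : ℝ) := by
  have h := sum_range_inv_eq_harmonic k
  have : (0 : ℝ) ≤ ∑ j ∈ Finset.range k, 1 / ((k : ℝ) + 1 - j) :=
    Finset.sum_nonneg fun j hj => by
      have : (j : ℝ) < k := Nat.cast_lt.2 (Finset.mem_range.1 hj)
      exact one_div_nonneg.2 (by linarith)
  linarith

theorem ratioOfExpectations_plfu_le [Fintype M] (π : PMF M) (k : ℕ) (T : Finset M) (v : M)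
    (C₀ : Finset M) (hT : IsMostFrequent π k T) (hv : IsLeastFrequentIn π T v)
    (hC : C₀.card ≤ k) :
    ratioOfExpectations π (plfuCost v T) (optCost k C₀) ≤
      ENNReal.ofReal (2 * (harmonic (k + 1) : ℝ)) := by
  set p : M → ℝ := fun x => (π x).toReal with hpdef
  have hp : ∀ x, 0 ≤ p x := fun x => ENNReal.toReal_nonneg
  have h1 : ∑ x, p x = 1 := by
    rw [hpdef, ← ENNReal.toReal_sum fun x _ => π.apply_ne_top x,
      (tsum_fintype fun x => π x).symm.trans π.tsum_coe, ENNReal.toReal_one]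
  have hTv : ∀ x ∈ T, p v ≤ p x := fun x hx =>
    ENNReal.toReal_mono (π.apply_ne_top x) (hv.2 x hx)
  have hvT : ∀ x ∉ T, p x ≤ p v := fun x hx =>
    ENNReal.toReal_mono (π.apply_ne_top v) (hT.2 v hv.1 x hx)
  have hk : 1 ≤ k := hT.1 ▸ Finset.card_pos.2 ⟨v, hv.1⟩
  obtain ⟨P, hP, hΦ⟩ := exists_isChain hT.1
  set H : ℝ := (harmonic (k + 1) : ℝ)
  have hH : 1 ≤ H := one_le_harmonic_succ k
  set μ : ℝ := 1 - ∑ x ∈ T, p x with hμ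
  set B : ℕ → ℝ := fun n => meanCost p n fun σ => (optCost k C₀ σ : ℝ) with hB
  have hbound : ∀ n : ℕ, n * μ / H - k ≤ B n := fun n => by
    have ha := hP.mul_le_meanCost_count hp h1 hT.1 hTv hvT n
    rw [hΦ, add_zero] at ha
    have hb := meanCost_mono hp n (f := fun σ => (chainCount k P σ : ℝ))
      (g := fun σ => (optCost k C₀ σ : ℝ) + k)
      fun σ => by exact_mod_cast chainCount_le_optCost hk hC hP σ
    rw [meanCost_add_const h1] at hb
    rw [sub_le_iff_le_add, div_le_iff₀' (by linarith)]
    exact ha.trans (mul_le_mul_of_nonneg_left hb (by linarith))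
  have hratio : ∀ n, expectedCost π n (plfuCost v T) / expectedCost π n (optCost k C₀) =
      ENNReal.ofReal (2 * (n * μ)) / ENNReal.ofReal (B n) := fun n => by
    rw [expectedCost_eq_ofReal, expectedCost_eq_ofReal, meanCost_plfu h1 hv.1]
  simp only [ratioOfExpectations, hratio]
  have hμ0 : 0 ≤ μ := by
    have := Finset.sum_le_univ_sum_of_nonneg (s := T) hp
    linarith
  rcases hμ0.eq_or_lt with h0 | h0
  -- With `μ = 0` PLFU has mean cost zero, so every ratio is 0, even when the denominator vanishes.
  · simp [← h0]
  · have hlim : Filter.Tendsto (fun n : ℕ => ENNReal.ofReal (2 * μ / (μ / H - k / n)))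
        Filter.atTop (nhds (ENNReal.ofReal (2 * H))) := by
      refine ENNReal.tendsto_ofReal ?_
      have h2 : Filter.Tendsto (fun n : ℕ => μ / H - (k : ℝ) / n) Filter.atTop
          (nhds (μ / H - 0)) :=
        tendsto_const_nhds.sub (tendsto_const_div_atTop_nhds_zero_nat _)
      rw [sub_zero] at h2
      have hne : μ / H ≠ 0 := (div_pos h0 (by linarith)).ne'
      have h3 := (tendsto_const_nhds (x := 2 * μ)).div h2 hne
      have : 2 * μ / (μ / H) = 2 * H := by field_simp
      rwa [this] at h3
    rw [← hlim.limsup_eq]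
    refine Filter.limsup_le_limsup ?_
    have hev : ∀ᶠ n : ℕ in Filter.atTop, k * H / μ < n :=
      tendsto_natCast_atTop_atTop.eventually_gt_atTop (k * H / μ)
    filter_upwards [hev, Filter.eventually_gt_atTop 0] with n hn hn0
    have hn0' : (0 : ℝ) < n := Nat.cast_pos.2 hn0
    have hpos : 0 < n * μ / H - k := by
      rw [div_lt_iff₀ h0] at hn
      rw [sub_pos, lt_div_iff₀ (by linarith)]
      exact hn
    have hBpos : 0 < B n := hpos.trans_le (hbound n)
    rw [← ENNReal.ofReal_div_of_pos hBpos]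
    refine ENNReal.ofReal_le_ofReal ?_
    have heq : 2 * μ / (μ / H - k / n) = 2 * (n * μ) / (n * μ / H - k) := by
      have : n * μ / H - k = n * (μ / H - k / n) := by field_simp
      rw [this, mul_left_comm, mul_div_mul_left _ _ hn0'.ne']
    rw [heq]
    exact div_le_div_of_nonneg_left (by positivity) hpos (hbound n)

theorem harmonic_succ_isBigO_log :
    (fun k : ℕ => 2 * (harmonic (k + 1) : ℝ)) =O[Filter.atTop] (fun k : ℕ => Real.log k) := by
  -- `2 * (2 + log k) ≤ 6 * log k` once `log k ≥ 1`, which holds for `k ≥ 3 > e`.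
  refine Asymptotics.IsBigO.of_bound 6 ?_
  filter_upwards [Filter.eventually_ge_atTop 3] with k hk
  have hk' : (3 : ℝ) ≤ k := by exact_mod_cast hk
  have hlog : 1 ≤ Real.log k := by
    rw [Real.le_log_iff_exp_le (by linarith)]
    linarith [Real.exp_one_lt_d9]
  have hsucc : (harmonic (k + 1) : ℝ) ≤ 2 + Real.log k := by
    have h1 := harmonic_le_one_add_log k
    have h2 : ((k : ℝ) + 1)⁻¹ ≤ 1 := inv_le_one_of_one_le₀ (by linarith)
    rw [harmonic_succ]
    push_cast
    linarith
  have h0 := one_le_harmonic_succ k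
  rw [Real.norm_of_nonneg (by linarith), Real.norm_of_nonneg (by linarith)]
  linarith

end Paging

theorem mainTheorem7 :
    (∀ (M : Type*) [Fintype M] [DecidableEq M] (π : PMF M) (k : ℕ) (T : Finset M) (v : M)
      (C₀ : Finset M),
      Paging.IsMostFrequent π k T → Paging.IsLeastFrequentIn π T v → C₀.card ≤ k →
      Paging.ratioOfExpectations π (Paging.plfuCost v T) (Paging.optCost k C₀)
        ≤ ENNReal.ofReal (2 * (harmonic (k + 1) : ℝ))) ∧
    (fun k : ℕ => 2 * (harmonic (k + 1) : ℝ)) =O[Filter.atTop] (fun k : ℕ => Real.log k) :=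
  ⟨fun _ _ _ π k T v C₀ hT hv hC => Paging.ratioOfExpectations_plfu_le π k T v C₀ hT hv hC,
    Paging.harmonic_succ_isBigO_log⟩
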